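/- Let $n\ge 0$ and $[n]=\{1,\dots,n\}$. **Lattice path matroids.** Identify a monotone lattice path with $n$ unit north/east steps with the set $B\subseteq[n]$ of the indices of its north steps. For two lattice paths $U,L\subseteq[n]$ with $|U|=|L|$ and $L$ never going above $U$, let $M[U,L]$ be the lattice path matroid on $[n]$ whose bases are the lattice paths with the same end points lying weakly between $L$ and $U$. Let $\mathcal P_n$ be the set of all lattice path matroids on $[n]$ ordered by $M'\le_q M$ iff $M'$ is a matroid quotient of $M$, i.e. there are a finite matroid $N$ and a subset $T$ of its ground set with $M=N\setminus T$ and $M'=N/T$. Label a cover relation $M[U',L']\lessdot M[U,L]$ of $\mathcal P_n$ by the pair $(\ell,u)$ with $L\setminus L'=\{\ell\}$ and $U\setminus U'=\{u\}$. A maximal chain $U_{0,n}=x_0\lessdot x_1\lessdot\cdots\lessdot x_n=U_{n,n}$ of $\mathcal P_n$, where $U_{0,n}=M[\emptyset,\emptyset]$ and $U_{n,n}=M[[n],[n]]$, is identified with its sequence of labels $((\ell_1,u_1),\dots,(\ell_n,u_n))$, and is called *falling* if for no $1\le i<n$ one has $(\ell_i,u_i)<(\ell_{i+1},u_{i+1})$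 in the componentwise (product) order on $[n]\times[n]$. **Permutations.** Let $s_k\in S_n$ $(1\le k\le n-1)$ be the transposition of $k$ and $k+1$, and let $w_0\in S_n$, $w_0(i)=n+1-i$, be the longest permutation. A reduced word of $\sigma$ is an expression $\sigma=s_{k_1}\cdots s_{k_l}$ with $l$ minimal. For $\sigma\in S_n$ let $C_\sigma$ be the set of all falling chains of $\mathcal P_n$ of the form $((\sigma(1),\tau(1)),\dots,(\sigma(n),\tau(n)))$ with $\tau\in S_n$. **Proposition.** Let $\sigma,\sigma'\in S_n$. 1. $\sigma'=w_0\sigma w_0$ if and only if there is a reduced word $\sigma=s_{k_1}s_{k_2}\cdots s_{k_l}$ such that $s_{n-k_1}s_{n-k_2}\cdots s_{n-k_l}$ is a reduced word of $\sigma'$. 2. If $\sigma'=w_0\sigma w_0$, then the map $$((\ell_1,u_1),\dots,(\ell_n,u_n))\longmapsto((n+1-\ell_n,\,n+1-u_n),\dots,(n+1-\ell_1,\,n+1-u_1))$$ restricts to a bijection from $C_\sigma$ onto $C_{\sigma'}$; in particular $|C_\sigma|=|C_{\sigma'}|$. -/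

import Mathlib

namespace LatticePathMatroid

open Finset

/-- A monotone lattice path from `(0,0)` to `(n-k,k)` is encoded by the set `B ⊆ {1,…,n}` of the
indices of its north steps (so `|B| = k`); `height B j` is the height of the path after `j` steps,
that is, after `j` steps the path is at the point `(j - height B j, height B j)`. -/
def height (B : Finset ℕ) (j : ℕ) : ℕ := (B.filter (fun b => b ≤ j)).card

/-- The path of `B` has `n` steps, ends at the same point as the paths of `U` and `L`, and lies
weakly below the path of `U` and weakly above the path of `L`. -/
def IsBetween (n : ℕ) (U L B : Finset ℕ) : Prop :=
  B ⊆ Icc 1 n ∧ B.card = U.card ∧ B.card = L.card ∧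
    ∀ j, height L j ≤ height B j ∧ height B j ≤ height U j

/-- The data of a lattice path matroid on the ground set `[n] = {1,…,n}`: an upper path `U` and a
lower path `L`, with the same end points, such that `L` never goes above `U`. -/
@[ext]
structure LPM (n : ℕ) where
  U : Finset ℕ
  L : Finset ℕ
  U_subset : U ⊆ Icc 1 n
  L_subset : L ⊆ Icc 1 n
  card_eq : U.card = L.card
  noncrossing : ∀ j, height L j ≤ height U j

theorem height_succ (B : Finset ℕ) (j : ℕ) :
    height B (j + 1) = height B j + if j + 1 ∈ B then 1 else 0 := by
  unfold height
  split_ifs with h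
  · have : B.filter (fun b => b ≤ j + 1) = insert (j + 1) (B.filter (fun b => b ≤ j)) := by
      ext a
      simp only [mem_filter, mem_insert]
      constructor
      · rintro ⟨h1, h2⟩
        rcases Nat.lt_or_ge j a with h3 | h3
        · left; omega
        · exact Or.inr ⟨h1, h3⟩
      · rintro (rfl | ⟨h1, h2⟩)
        · exact ⟨h, le_rfl⟩
        · exact ⟨h1, by omega⟩
    rw [this, card_insert_of_notMem (by simp)]
  · congr 1
    ext a
    simp only [mem_filter]
    constructor
    · rintro ⟨h1, h2⟩
      refine ⟨h1, ?_⟩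
      by_contra h3
      exact h ((show j + 1 = a by omega) ▸ h1)
    · rintro ⟨h1, h2⟩
      exact ⟨h1, by omega⟩

theorem height_zero {n : ℕ} {B : Finset ℕ} (hB : B ⊆ Icc 1 n) : height B 0 = 0 := by
  unfold height
  rw [card_eq_zero, filter_eq_empty_iff]
  intro a ha
  have := mem_Icc.1 (hB ha)
  omega

theorem height_last {n : ℕ} {B : Finset ℕ} (hB : B ⊆ Icc 1 n) : height B n = B.card := by
  unfold height
  rw [filter_true_of_mem]
  intro a ha
  exact (mem_Icc.1 (hB ha)).2

theorem height_exchange {B : Finset ℕ} {x y : ℕ} (hx : x ∈ B) (hy : y ∉ B) (j : ℕ) :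
    height (insert y (B.erase x)) j + (if x ≤ j then 1 else 0) =
      height B j + if y ≤ j then 1 else 0 := by
  unfold height
  simp only [card_filter]
  rw [sum_insert (by simp [hy]), ← add_sum_erase B _ hx]
  ring

theorem height_injective {n : ℕ} {B C : Finset ℕ} (hB : B ⊆ Icc 1 n) (hC : C ⊆ Icc 1 n)
    (h : ∀ j, height B j = height C j) : B = C := by
  ext a
  rcases Nat.eq_zero_or_pos a with rfl | ha
  · constructor
    · intro h'; simpa using hB h'
    · intro h'; simpa using hC h'
  · obtain ⟨j, rfl⟩ : ∃ j, a = j + 1 := ⟨a - 1, by omega⟩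
    have h1 := height_succ B j
    have h2 := height_succ C j
    rw [h, h, h2] at h1
    by_cases p : j + 1 ∈ B <;> by_cases q : j + 1 ∈ C <;> simp_all

theorem IsBetween.exchange {n : ℕ} {U L B₁ B₂ : Finset ℕ} (h₁ : IsBetween n U L B₁)
    (h₂ : IsBetween n U L B₂) {x : ℕ} (hx₁ : x ∈ B₁) (hx₂ : x ∉ B₂) :
    ∃ y, y ∈ B₂ ∧ y ∉ B₁ ∧ IsBetween n U L (insert y (B₁.erase x)) := by
  have hxn := mem_Icc.1 (h₁.1 hx₁)
  have key : ∀ y, y ∈ B₂ → y ∉ B₁ →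
      (∀ j, height L j ≤ height (insert y (B₁.erase x)) j ∧
        height (insert y (B₁.erase x)) j ≤ height U j) →
      IsBetween n U L (insert y (B₁.erase x)) := by
    intro y hy2 hy1 hh
    have hc : (insert y (B₁.erase x)).card = B₁.card := by
      rw [card_insert_of_notMem (by simp [hy1]), card_erase_add_one hx₁]
    refine ⟨?_, hc.trans h₁.2.1, hc.trans h₁.2.2.1, hh⟩
    intro a ha
    rcases mem_insert.1 ha with rfl | ha
    · exact h₂.1 hy2
    · exact h₁.1 (mem_of_mem_erase ha)
  rcases Nat.lt_or_ge (height B₂ x) (height B₁ x) with hd | hd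
  · have fwd : ∀ m, (∀ y, x < y → y ≤ x + m → y ∈ B₂ → y ∈ B₁) →
        height B₂ (x + m) < height B₁ (x + m) := by
      intro m
      induction m with
      | zero => intro _; simpa using hd
      | succ m ih =>
        intro hm
        have h3 := ih (fun y hy hy' => hm y hy (by omega))
        have h4 := hm (x + m + 1) (by omega) (by omega)
        rw [← add_assoc, height_succ, height_succ]
        by_cases p : x + m + 1 ∈ B₂
        · simp only [p, h4 p, if_true]; omega
        · simp only [p, if_false]; omega
    have hex : ∃ y, x < y ∧ y ∈ B₂ ∧ y ∉ B₁ := by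
      by_contra hne
      push Not at hne
      have h5 := fwd (n - x) (fun y hy _ hy2 => hne y hy hy2)
      rw [Nat.add_sub_cancel' hxn.2, height_last h₁.1, height_last h₂.1, h₁.2.1, h₂.2.1] at h5
      exact lt_irrefl _ h5
    classical
    obtain ⟨hy0, hy2, hy1⟩ := Nat.find_spec hex
    refine ⟨Nat.find hex, hy2, hy1, key _ hy2 hy1 fun j => ?_⟩
    have he := height_exchange hx₁ hy1 j
    have hb1 := h₁.2.2.2 j
    have hb2 := h₂.2.2.2 j
    by_cases hj : x ≤ j
    · by_cases hj' : Nat.find hex ≤ j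
      · simp only [hj, hj', if_true] at he; omega
      · have h6 := fwd (j - x) (fun y hy hy' hyB => by
          by_contra hyB1
          exact Nat.find_min hex (m := y) (by omega) ⟨hy, hyB, hyB1⟩)
        rw [Nat.add_sub_cancel' hj] at h6
        simp only [hj, hj', if_true, if_false] at he; omega
    · have hj' : ¬ Nat.find hex ≤ j := by omega
      simp only [hj, hj', if_false] at he; omega
  · have hx' : height B₁ (x - 1) < height B₂ (x - 1) := by
      have h3 := height_succ B₁ (x - 1)
      have h4 := height_succ B₂ (x - 1)
      rw [Nat.sub_add_cancel hxn.1] at h3 h4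
      simp only [hx₁, hx₂, if_true, if_false] at h3 h4
      omega
    have bwd : ∀ m, m ≤ x - 1 → (∀ y, x - 1 - m < y → y < x → y ∈ B₂ → y ∈ B₁) →
        height B₁ (x - 1 - m) < height B₂ (x - 1 - m) := by
      intro m
      induction m with
      | zero => intro _ _; simpa using hx'
      | succ m ih =>
        intro hmx hm
        have h3 := ih (by omega) (fun y hy hy' => hm y (by omega) hy')
        have h4 := hm (x - 1 - m) (by omega) (by omega)
        obtain ⟨i, hi⟩ : ∃ i, x - 1 - m = i + 1 := ⟨x - 1 - m - 1, by omega⟩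
        have hi' : x - 1 - (m + 1) = i := by omega
        rw [hi']
        rw [hi] at h3 h4
        rw [height_succ, height_succ] at h3
        by_cases p : i + 1 ∈ B₂
        · simp only [p, h4 p, if_true] at h3; omega
        · simp only [p, if_false] at h3; omega
    obtain ⟨m, hm⟩ : ∃ m, m = (B₂ \ B₁).filter (fun y => y < x) := ⟨_, rfl⟩
    have hne : m.Nonempty := by
      by_contra hne
      rw [not_nonempty_iff_eq_empty] at hne
      have h5 := bwd (x - 1) le_rfl (fun y _ hy' hy2 => by
        by_contra hy1
        have : y ∈ m := by rw [hm]; simp [hy', hy2, hy1]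
        simp [hne] at this)
      rw [Nat.sub_self, height_zero h₁.1, height_zero h₂.1] at h5
      exact lt_irrefl _ h5
    obtain ⟨y, hmem, hmax⟩ : ∃ y ∈ m, ∀ z ∈ m, z ≤ y :=
      ⟨m.max' hne, m.max'_mem hne, fun z hz => m.le_max' z hz⟩
    rw [hm] at hmem
    simp only [mem_filter, mem_sdiff] at hmem
    obtain ⟨⟨hy2, hy1⟩, hyx⟩ := hmem
    refine ⟨y, hy2, hy1, key y hy2 hy1 fun j => ?_⟩
    have he := height_exchange hx₁ hy1 j
    have hb1 := h₁.2.2.2 j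
    have hb2 := h₂.2.2.2 j
    by_cases hj : y ≤ j
    · by_cases hj' : x ≤ j
      · simp only [hj, hj', if_true] at he; omega
      · have h6 := bwd (x - 1 - j) (by omega) (fun z hz hz' hzB => by
          by_contra hzB1
          have := hmax z (by rw [hm]; simp [hz', hzB, hzB1])
          omega)
        have h7 : x - 1 - (x - 1 - j) = j := by omega
        rw [h7] at h6
        simp only [hj, hj', if_true, if_false] at he; omega
    · have hj' : ¬ x ≤ j := by omega
      simp only [hj, hj', if_false] at he; omega

namespace LPM

variable {n : ℕ}

theorem isBetween_U (x : LPM n) : IsBetween n x.U x.L x.U :=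
  ⟨x.U_subset, rfl, x.card_eq, fun j => ⟨x.noncrossing j, le_rfl⟩⟩

theorem isBetween_L (x : LPM n) : IsBetween n x.U x.L x.L :=
  ⟨x.L_subset, x.card_eq.symm, rfl, fun j => ⟨le_rfl, x.noncrossing j⟩⟩

/-- The lattice path matroid `M[U,L]` on the ground set `{1,…,n}`: its bases are the lattice paths
lying between `U` and `L`. -/
protected def toMatroid (x : LPM n) : Matroid ℕ :=
  Matroid.ofIsBaseOfFinite (E := (Icc 1 n : Finset ℕ)) (Finset.finite_toSet _)
    (fun X => ∃ B : Finset ℕ, (B : Set ℕ) = X ∧ IsBetween n x.U x.L B)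
    ⟨_, x.U, rfl, x.isBetween_U⟩
    (by
      rintro _ _ ⟨B₁, rfl, h₁⟩ ⟨B₂, rfl, h₂⟩ a ha
      obtain ⟨y, hy2, hy1, hy⟩ := h₁.exchange h₂ (x := a) (by simpa using ha.1) (by simpa using ha.2)
      exact ⟨y, ⟨by simpa using hy2, by simpa using hy1⟩, _, by simp, hy⟩)
    (by
      rintro _ ⟨B, rfl, h⟩
      exact_mod_cast h.1)

/-- A lattice path matroid determines its upper and lower path, so `LPM n` is (in bijection with)
the set of all lattice path matroids on `[n]`. -/
theorem toMatroid_injective : Function.Injective (LPM.toMatroid (n := n)) := by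
  have key : ∀ x y : LPM n, x.toMatroid = y.toMatroid → ∀ B : Finset ℕ,
      IsBetween n x.U x.L B → IsBetween n y.U y.L B := by
    intro x y h B hB
    have h1 : x.toMatroid.IsBase B := ⟨B, rfl, hB⟩
    rw [h] at h1
    obtain ⟨C, hC, hC'⟩ := h1
    rwa [← Finset.coe_injective hC]
  intro x y h
  have a := key x y h _ x.isBetween_U
  have b := key x y h _ x.isBetween_L
  have c := key y x h.symm _ y.isBetween_U
  have d := key y x h.symm _ y.isBetween_L
  exact LPM.ext
    (height_injective x.U_subset y.U_subset
      fun j => le_antisymm (a.2.2.2 j).2 (c.2.2.2 j).2)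
    (height_injective x.L_subset y.L_subset
      fun j => le_antisymm (d.2.2.2 j).1 (b.2.2.2 j).1)

end LPM

/-- `M'` is a matroid quotient of `M`: there are a (finite) matroid `N` and a subset `T` of its
ground set such that `M = N \ T` (deletion) and `M' = N / T` (contraction). The ambient type `ℕ`
leaves room for arbitrarily many elements outside the ground set `{1,…,n}` of `M` and `M'`. -/
def IsQuotient (M' M : Matroid ℕ) : Prop :=
  ∃ (N : Matroid ℕ) (T : Set ℕ), N.Finite ∧ T ⊆ N.E ∧ M = N.delete T ∧ M' = N.contract T

/-- The quotient order `≤_q` on the set of lattice path matroids on `[n]`. -/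
instance (n : ℕ) : LE (LPM n) := ⟨fun x y => IsQuotient x.toMatroid y.toMatroid⟩

/-- The strict quotient order, with respect to which the cover relation `⋖` is formed. -/
instance (n : ℕ) : LT (LPM n) := ⟨fun x y => x ≤ y ∧ x ≠ y⟩

/-- The minimum `U_{0,n}`: both paths consist of east steps only. -/
def LPM.zero (n : ℕ) : LPM n := ⟨∅, ∅, by simp, by simp, rfl, fun _ => le_rfl⟩

/-- The maximum `U_{n,n}`: both paths consist of north steps only. -/
def LPM.full (n : ℕ) : LPM n :=
  ⟨Icc 1 n, Icc 1 n, Subset.rfl, Subset.rfl, rfl, fun _ => le_rfl⟩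

/-- The good pair labeling: the cover relation `x ⋖ y` has the label `p = (ℓ, u)`, where
`L(y) \ L(x) = {ℓ}` and `U(y) \ U(x) = {u}`. -/
def HasLabel {n : ℕ} (x y : LPM n) (p : ℕ × ℕ) : Prop :=
  y.L \ x.L = {p.1} ∧ y.U \ x.U = {p.2}

/-- `c` is the label sequence, read from the bottom to the top, of a maximal chain
`U_{0,n} = x₀ ⋖ x₁ ⋖ ⋯ ⋖ xₙ = U_{n,n}` of lattice path matroids in the quotient order. (The chain
is determined by its label sequence, and is identified with it.) -/
def IsMaximalChain (n : ℕ) (c : Fin n → ℕ × ℕ) : Prop :=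
  ∃ x : Fin (n + 1) → LPM n, x 0 = LPM.zero n ∧ x (Fin.last n) = LPM.full n ∧
    ∀ i : Fin n, x i.castSucc ⋖ x i.succ ∧ HasLabel (x i.castSucc) (x i.succ) (c i)

/-- A falling chain: a maximal chain in which no label is strictly smaller than the next one.
Labels are compared in the product order on `ℕ × ℕ`. -/
def IsFallingChain (n : ℕ) (c : Fin n → ℕ × ℕ) : Prop :=
  IsMaximalChain n c ∧ ∀ i j : Fin n, (j : ℕ) = i + 1 → ¬ c i < c j

/-- The sequence `C_{(σ,τ)} = ((σ(1),τ(1)), …, (σ(n),τ(n)))`. The type `Fin n` is `{0,…,n-1}`, so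
the element `i` of `Fin n` stands for the element `i + 1` of `[n]`. -/
def chainOfPerms {n : ℕ} (σ τ : Equiv.Perm (Fin n)) : Fin n → ℕ × ℕ :=
  fun i => ((σ i : ℕ) + 1, (τ i : ℕ) + 1)

/-- The set `C_σ` of the falling chains of the form `C_{(σ,τ)}`. -/
def fallingChains {n : ℕ} (σ : Equiv.Perm (Fin n)) : Set (Fin n → ℕ × ℕ) :=
  {c | IsFallingChain n c ∧ ∃ τ : Equiv.Perm (Fin n), c = chainOfPerms σ τ}

/-- Reverse a sequence of pairs and complement its entries:
`((ℓ₁,u₁),…,(ℓₙ,uₙ)) ↦ ((n+1-ℓₙ,n+1-uₙ),…,(n+1-ℓ₁,n+1-u₁))`. -/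
def reverseComplement (n : ℕ) (c : Fin n → ℕ × ℕ) : Fin n → ℕ × ℕ :=
  fun i => (n + 1 - (c i.rev).1, n + 1 - (c i.rev).2)

/-- The longest permutation `w₀ : i ↦ n + 1 - i`. -/
def longest (n : ℕ) : Equiv.Perm (Fin n) := Fin.revPerm

/-- The adjacent transpositions of `[n]`: the index `k : Fin (n - 1)` stands for `s_{k+1}`, the
transposition of `k + 1` and `k + 2` in `[n]`, that is, of `k` and `k + 1` in `Fin n`. Then
`k.rev` stands for `s_{n-(k+1)}`. -/
def adjacentSwap (n : ℕ) (k : Fin (n - 1)) : Equiv.Perm (Fin n) :=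
  Equiv.swap ⟨k, by omega⟩ ⟨k + 1, by omega⟩

/-- The product of a word in the adjacent transpositions. -/
def wordProd {n : ℕ} (w : List (Fin (n - 1))) : Equiv.Perm (Fin n) :=
  (w.map (adjacentSwap n)).prod

/-- `w` is a reduced word of `σ`: its product is `σ`, and no shorter word has the product `σ`. -/
def IsReducedWord {n : ℕ} (w : List (Fin (n - 1))) (σ : Equiv.Perm (Fin n)) : Prop :=
  wordProd w = σ ∧ ∀ v : List (Fin (n - 1)), wordProd v = σ → w.length ≤ v.length

end LatticePathMatroid

/-! ### Relabelling a matroid commutes with duality and minors -/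

namespace Matroid

variable {α β : Type*}

/-! Everything comes from one anti-automorphism of the quotient order: dualize and relabel by `i ↦ n
+ 1 - i`. Duality exchanges deletion and contraction, hence reverses quotients (`IsQuotient.dual`).
On paths the operation is a half turn combined with the exchange of north and east steps, so it
keeps upper paths upper and sends `M[U,L]` to another lattice path matroid
(`LPM.toMatroid_reverseDual`).

Being an order-reversing involution, it reverses maximal chains, and labels become `n + 1 - ℓ`, `n +
1 - u`. Reversing positions and complementing entries each flip the comparison of consecutive
labels, so falling chains stay falling. On the permutations indexing a chain this is conjugation by
`w₀`.

For words, conjugation by `w₀` is an involutive automorphism with `s_k ↦ s_{n-k}`; it acts letter by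
letter, preserving length and therefore reducedness. -/

theorem mapEquiv_dual (M : Matroid α) (e : α ≃ β) : M✶.mapEquiv e = (M.mapEquiv e)✶ := by
  rw [mapEquiv_eq_map, mapEquiv_eq_map, map_dual]

theorem mapEquiv_delete (M : Matroid α) (e : α ≃ β) (D : Set α) :
    (M.delete D).mapEquiv e = (M.mapEquiv e).delete (e '' D) := by
  refine ext_indep (by simp [Set.image_sdiff e.injective]) fun I _ => ?_
  simp only [mapEquiv_indep_iff, delete_indep_iff]
  rw [← Set.disjoint_image_iff e.injective, e.image_symm_image]

/-- Contraction is deletion in the dual. -/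
theorem mapEquiv_contract (M : Matroid α) (e : α ≃ β) (C : Set α) :
    (M.contract C).mapEquiv e = (M.mapEquiv e).contract (e '' C) := by
  rw [← dual_inj, ← mapEquiv_dual, dual_contract, mapEquiv_delete, mapEquiv_dual, dual_contract]

end Matroid

namespace LatticePathMatroid

open Finset

/-! ### Quotients under duality and relabelling -/

/-- The dual of `N`, with the same `T`, is a witness: dualizing turns `N \ T` into a contraction and
`N / T` into a deletion. -/
theorem IsQuotient.dual {M' M : Matroid ℕ} (h : IsQuotient M' M) :
    IsQuotient M.dual M'.dual := by
  obtain ⟨N, T, hN, hT, rfl, rfl⟩ := h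
  exact ⟨N.dual, T, inferInstance, hT, by simp, by simp⟩

theorem IsQuotient.mapEquiv {M' M : Matroid ℕ} (h : IsQuotient M' M) (e : ℕ ≃ ℕ) :
    IsQuotient (M'.mapEquiv e) (M.mapEquiv e) := by
  obtain ⟨N, T, hN, hT, rfl, rfl⟩ := h
  exact ⟨N.mapEquiv e, e '' T, inferInstance, Set.image_mono hT, N.mapEquiv_delete e T,
    N.mapEquiv_contract e T⟩

/-! ### Rotated lattice paths -/

/-- The path of `B`, rotated by a half turn and with its north and east steps exchanged: the
complement in `[n]` of the set of all `n + 1 - b` with `b ∈ B`. -/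
def reverseCompl (n : ℕ) (B : Finset ℕ) : Finset ℕ :=
  (Icc 1 n).filter fun i => n + 1 - i ∉ B

theorem mem_reverseCompl {n : ℕ} {B : Finset ℕ} {i : ℕ} :
    i ∈ reverseCompl n B ↔ (1 ≤ i ∧ i ≤ n) ∧ n + 1 - i ∉ B := by
  simp [reverseCompl]

theorem reverseCompl_subset (n : ℕ) (B : Finset ℕ) : reverseCompl n B ⊆ Icc 1 n :=
  filter_subset _ _

theorem reverseCompl_reverseCompl {n : ℕ} {B : Finset ℕ} (hB : B ⊆ Icc 1 n) :
    reverseCompl n (reverseCompl n B) = B := by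
  ext i
  simp only [mem_reverseCompl]
  constructor
  · rintro ⟨h, h'⟩
    by_contra hi
    refine h' ⟨by omega, ?_⟩
    rwa [show n + 1 - (n + 1 - i) = i by omega]
  · intro hi
    have h := mem_Icc.1 (hB hi)
    refine ⟨h, fun h' => h'.2 ?_⟩
    rwa [show n + 1 - (n + 1 - i) = i by omega]

theorem reverseCompl_sdiff {n : ℕ} {B C : Finset ℕ} {a : ℕ} (hB : B ⊆ Icc 1 n)
    (h : B \ C = {a}) : reverseCompl n C \ reverseCompl n B = {n + 1 - a} := by
  have key : ∀ b, b ∈ B ∧ b ∉ C ↔ b = a := fun b => by rw [← mem_sdiff, h, mem_singleton]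
  have ha := mem_Icc.1 (hB ((key a).2 rfl).1)
  ext i
  simp only [mem_sdiff, mem_reverseCompl, mem_singleton, not_and, not_not]
  constructor
  · rintro ⟨⟨hi, hiC⟩, hiB⟩
    have := (key _).1 ⟨hiB hi, hiC⟩
    omega
  · rintro rfl
    have : n + 1 - (n + 1 - a) = a := by omega
    rw [this]
    exact ⟨⟨by omega, ((key a).2 rfl).2⟩, fun _ => ((key a).2 rfl).1⟩

/-- The first `j` steps of the new path are the last `j` steps of the old one with north and east
exchanged; of these, `B.card - height B (n - j)` were north. The additive form avoids truncated
subtraction. -/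
theorem height_reverseCompl {n : ℕ} {B : Finset ℕ} (hB : B ⊆ Icc 1 n) {j : ℕ} (hj : j ≤ n) :
    height (reverseCompl n B) j + B.card = j + height B (n - j) := by
  induction j with
  | zero => rw [height_zero (reverseCompl_subset n B), Nat.sub_zero, height_last hB]
  | succ j ih =>
    have h := ih (by omega)
    have h' := height_succ B (n - (j + 1))
    rw [show n - (j + 1) + 1 = n - j by omega] at h'
    rw [height_succ]
    have hm : j + 1 ∈ reverseCompl n B ↔ n - j ∉ B := by
      rw [mem_reverseCompl, show n + 1 - (j + 1) = n - j by omega]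
      exact and_iff_right (by omega)
    by_cases p : n - j ∈ B <;> simp only [hm, p, not_true, not_false_eq_true, if_true, if_false]
      at h' ⊢ <;> omega

theorem card_reverseCompl {n : ℕ} {B : Finset ℕ} (hB : B ⊆ Icc 1 n) :
    (reverseCompl n B).card + B.card = n := by
  have h := height_reverseCompl hB le_rfl
  rwa [height_last (reverseCompl_subset n B), Nat.sub_self, height_zero hB] at h

theorem height_of_le {n : ℕ} {B : Finset ℕ} (hB : B ⊆ Icc 1 n) {j : ℕ} (hj : n ≤ j) :
    height B j = B.card := by
  unfold height
  rw [filter_true_of_mem]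
  intro a ha
  exact (mem_Icc.1 (hB ha)).2.trans hj

/-- By `height_reverseCompl`, the new height is the old height at `n - j` plus a term depending only
on `j` and the common cardinality. -/
theorem height_reverseCompl_mono {n : ℕ} {B C : Finset ℕ} (hB : B ⊆ Icc 1 n) (hC : C ⊆ Icc 1 n)
    (hBC : B.card = C.card) (h : ∀ j, height B j ≤ height C j) (j : ℕ) :
    height (reverseCompl n B) j ≤ height (reverseCompl n C) j := by
  rcases le_total j n with hj | hj
  · have h₁ := height_reverseCompl hB hj
    have h₂ := height_reverseCompl hC hj
    have := h (n - j)
    omega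
  · rw [height_of_le (reverseCompl_subset n B) hj, height_of_le (reverseCompl_subset n C) hj]
    have h₁ := card_reverseCompl hB
    have h₂ := card_reverseCompl hC
    omega

theorem IsBetween.reverseCompl {n : ℕ} {U L B : Finset ℕ} (hU : U ⊆ Icc 1 n) (hL : L ⊆ Icc 1 n)
    (h : IsBetween n U L B) :
    IsBetween n (reverseCompl n U) (reverseCompl n L) (reverseCompl n B) := by
  obtain ⟨hB, hBU, hBL, hh⟩ := h
  have h₁ := card_reverseCompl hB
  have h₂ := card_reverseCompl hU
  have h₃ := card_reverseCompl hL
  exact ⟨reverseCompl_subset n B, by omega, by omega, fun j =>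
    ⟨height_reverseCompl_mono hL hB hBL.symm (fun j => (hh j).1) j,
      height_reverseCompl_mono hB hU hBU (fun j => (hh j).2) j⟩⟩

theorem isBetween_reverseCompl_iff {n : ℕ} {U L B : Finset ℕ} (hU : U ⊆ Icc 1 n)
    (hL : L ⊆ Icc 1 n) (hB : B ⊆ Icc 1 n) :
    IsBetween n (reverseCompl n U) (reverseCompl n L) B ↔
      IsBetween n U L (reverseCompl n B) := by
  constructor
  · intro h
    have := h.reverseCompl (reverseCompl_subset n U) (reverseCompl_subset n L)
    rwa [reverseCompl_reverseCompl hU, reverseCompl_reverseCompl hL] at this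
  · intro h
    have := h.reverseCompl hU hL
    rwa [reverseCompl_reverseCompl hB] at this

/-! ### The dual lattice path matroid -/

/-- The permutation of `ℕ` reversing `[n]` and fixing all other numbers. -/
def reversal (n : ℕ) : Equiv.Perm ℕ :=
  Function.Involutive.toPerm (fun i => if 1 ≤ i ∧ i ≤ n then n + 1 - i else i) fun i => by
    by_cases h : 1 ≤ i ∧ i ≤ n
    · have h' : 1 ≤ n + 1 - i ∧ n + 1 - i ≤ n := by omega
      simp only [h, h', and_self, if_true]
      omega
    · simp only [h, if_false]

theorem reversal_symm (n : ℕ) : (reversal n).symm = reversal n := rfl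

theorem reversal_apply_of_mem {n i : ℕ} (h : 1 ≤ i ∧ i ≤ n) : reversal n i = n + 1 - i :=
  if_pos h

theorem reversal_apply_of_notMem {n i : ℕ} (h : ¬(1 ≤ i ∧ i ≤ n)) : reversal n i = i :=
  if_neg h

theorem reversal_image_Icc (n : ℕ) : reversal n '' (Icc 1 n : Finset ℕ) = (Icc 1 n : Finset ℕ) := by
  ext i
  rw [Equiv.image_eq_preimage_symm, reversal_symm]
  simp only [Set.mem_preimage, mem_coe, mem_Icc]
  by_cases h : 1 ≤ i ∧ i ≤ n
  · rw [reversal_apply_of_mem h]; omega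
  · rw [reversal_apply_of_notMem h]

theorem Icc_sdiff_reversal_image (n : ℕ) (B : Finset ℕ) :
    ((Icc 1 n : Finset ℕ) : Set ℕ) \ (reversal n '' (B : Set ℕ)) = reverseCompl n B := by
  ext i
  rw [Equiv.image_eq_preimage_symm, reversal_symm]
  simp only [Set.mem_sdiff, Set.mem_preimage, mem_coe, mem_Icc, mem_reverseCompl]
  exact and_congr_right fun h => by rw [reversal_apply_of_mem h]

namespace LPM

variable {n : ℕ}

/-- The dual of a lattice path matroid, relabelled along `i ↦ n + 1 - i`. -/
def reverseDual (x : LPM n) : LPM n where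
  U := reverseCompl n x.U
  L := reverseCompl n x.L
  U_subset := reverseCompl_subset n x.U
  L_subset := reverseCompl_subset n x.L
  card_eq := by
    have h₁ := card_reverseCompl x.U_subset
    have h₂ := card_reverseCompl x.L_subset
    have := x.card_eq
    omega
  noncrossing := height_reverseCompl_mono x.L_subset x.U_subset x.card_eq.symm x.noncrossing

theorem reverseDual_reverseDual (x : LPM n) : x.reverseDual.reverseDual = x :=
  LPM.ext (reverseCompl_reverseCompl x.U_subset) (reverseCompl_reverseCompl x.L_subset)

/-- Bases of the dual are complements of bases, and complementing after reversal is exactly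
`reverseCompl`. -/
theorem toMatroid_reverseDual (x : LPM n) :
    x.reverseDual.toMatroid = x.toMatroid.dual.mapEquiv (reversal n) := by
  refine Matroid.ext_isBase (reversal_image_Icc n).symm fun X hX => ?_
  change X ⊆ (Icc 1 n : Finset ℕ) at hX
  lift X to Finset ℕ using (Finset.finite_toSet _).subset hX
  have hX' : X ⊆ Icc 1 n := by exact_mod_cast hX
  have himg : reversal n '' (X : Set ℕ) ⊆ x.toMatroid.E := by
    have := Set.image_mono (f := reversal n) hX
    rwa [reversal_image_Icc] at this
  rw [Matroid.mapEquiv_isBase_iff, reversal_symm, Matroid.dual_isBase_iff himg]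
  change (∃ B : Finset ℕ, (B : Set ℕ) = X ∧
      IsBetween n (reverseCompl n x.U) (reverseCompl n x.L) B) ↔
    ∃ B : Finset ℕ, (B : Set ℕ) = ((Icc 1 n : Finset ℕ) : Set ℕ) \ (reversal n '' (X : Set ℕ)) ∧
      IsBetween n x.U x.L B
  rw [Icc_sdiff_reversal_image]
  simp only [coe_inj, exists_eq_left]
  exact isBetween_reverseCompl_iff x.U_subset x.L_subset hX'

theorem reverseDual_le {x y : LPM n} (h : x ≤ y) : y.reverseDual ≤ x.reverseDual := by
  change IsQuotient _ _
  rw [toMatroid_reverseDual, toMatroid_reverseDual]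
  exact (IsQuotient.dual h).mapEquiv _

theorem reverseDual_injective : Function.Injective (reverseDual (n := n)) :=
  Function.LeftInverse.injective reverseDual_reverseDual

theorem reverseDual_lt {x y : LPM n} (h : x < y) : y.reverseDual < x.reverseDual :=
  ⟨reverseDual_le h.1, fun e => h.2 (reverseDual_injective e).symm⟩

theorem reverseDual_covBy {x y : LPM n} (h : x ⋖ y) : y.reverseDual ⋖ x.reverseDual := by
  -- An intermediate `z` would, by the involution, yield one between `x` and `y`.
  refine ⟨reverseDual_lt h.1, fun z hz hz' => h.2 (c := z.reverseDual) ?_ ?_⟩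
  · simpa only [reverseDual_reverseDual] using reverseDual_lt hz'
  · simpa only [reverseDual_reverseDual] using reverseDual_lt hz

theorem reverseDual_full : (LPM.full n).reverseDual = LPM.zero n := by
  have : reverseCompl n (Icc 1 n) = ∅ := by
    ext i
    simp only [mem_reverseCompl, mem_Icc, notMem_empty, iff_false]
    omega
  exact LPM.ext this this

theorem reverseDual_zero : (LPM.zero n).reverseDual = LPM.full n := by
  rw [← reverseDual_full, reverseDual_reverseDual]

end LPM

/-! ### Maximal and falling chains -/

theorem HasLabel.reverseDual {n : ℕ} {x y : LPM n} {p : ℕ × ℕ} (h : HasLabel x y p) :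
    HasLabel y.reverseDual x.reverseDual (n + 1 - p.1, n + 1 - p.2) :=
  ⟨reverseCompl_sdiff y.L_subset h.1, reverseCompl_sdiff y.U_subset h.2⟩

theorem IsMaximalChain.reverseComplement {n : ℕ} {c : Fin n → ℕ × ℕ} (h : IsMaximalChain n c) :
    IsMaximalChain n (reverseComplement n c) := by
  obtain ⟨x, h0, hn, hx⟩ := h
  refine ⟨fun i => (x i.rev).reverseDual, ?_, ?_, fun i => ?_⟩
  · simp only [Fin.rev_zero, hn, LPM.reverseDual_full]
  · simp only [Fin.rev_last, h0, LPM.reverseDual_zero]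
  · simp only [Fin.rev_castSucc, Fin.rev_succ]
    exact ⟨LPM.reverseDual_covBy (hx i.rev).1, (hx i.rev).2.reverseDual⟩

theorem IsMaximalChain.label_mem {n : ℕ} {c : Fin n → ℕ × ℕ} (h : IsMaximalChain n c)
    (i : Fin n) : (c i).1 ∈ Icc 1 n ∧ (c i).2 ∈ Icc 1 n := by
  obtain ⟨x, -, -, hx⟩ := h
  obtain ⟨hL, hU⟩ := (hx i).2
  exact ⟨(x i.succ).L_subset (mem_sdiff.1 (hL ▸ mem_singleton_self _)).1,
    (x i.succ).U_subset (mem_sdiff.1 (hU ▸ mem_singleton_self _)).1⟩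

theorem IsMaximalChain.reverseComplement_reverseComplement {n : ℕ} {c : Fin n → ℕ × ℕ}
    (h : IsMaximalChain n c) :
    LatticePathMatroid.reverseComplement n (LatticePathMatroid.reverseComplement n c) = c := by
  funext i
  have hi := h.label_mem i
  simp only [mem_Icc] at hi
  simp only [LatticePathMatroid.reverseComplement, Fin.rev_rev]
  ext <;> dsimp only <;> omega

theorem IsFallingChain.reverseComplement {n : ℕ} {c : Fin n → ℕ × ℕ} (h : IsFallingChain n c) :
    IsFallingChain n (reverseComplement n c) := by
  refine ⟨h.1.reverseComplement, fun i j hij hlt => h.2 j.rev i.rev ?_ ?_⟩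
  · simp only [Fin.val_rev]
    omega
  -- Labels lie in `[n]`, so `n + 1 - ·` is not truncated and strictly reverses the order.
  · have hi := h.1.label_mem i.rev
    have hj := h.1.label_mem j.rev
    simp only [mem_Icc] at hi hj
    simp only [LatticePathMatroid.reverseComplement, Prod.lt_iff] at hlt ⊢
    omega

theorem reverseComplement_chainOfPerms {n : ℕ} (σ τ : Equiv.Perm (Fin n)) :
    reverseComplement n (chainOfPerms σ τ) =
      chainOfPerms (longest n * σ * longest n) (longest n * τ * longest n) := by
  funext i
  have h₁ := (σ i.rev).isLt
  have h₂ := (τ i.rev).isLt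
  simp only [reverseComplement, chainOfPerms, longest, Equiv.Perm.coe_mul, Function.comp_apply,
    Fin.revPerm_apply, Fin.val_rev]
  ext <;> dsimp only <;> omega

/-! ### Conjugation by the longest permutation and reduced words -/

theorem longest_mul_self (n : ℕ) : longest n * longest n = 1 := by
  ext i
  simp [longest]

theorem longest_inv (n : ℕ) : (longest n)⁻¹ = longest n :=
  inv_eq_of_mul_eq_one_right (longest_mul_self n)

theorem longest_conj_longest_conj {n : ℕ} (σ : Equiv.Perm (Fin n)) :
    longest n * (longest n * σ * longest n) * longest n = σ := by
  simp only [mul_assoc, longest_mul_self, mul_one]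
  rw [← mul_assoc, longest_mul_self, one_mul]

theorem mapsTo_reverseComplement {n : ℕ} (σ : Equiv.Perm (Fin n)) :
    Set.MapsTo (reverseComplement n) (fallingChains σ)
      (fallingChains (longest n * σ * longest n)) := by
  rintro _ ⟨hc, τ, rfl⟩
  exact ⟨hc.reverseComplement, _, reverseComplement_chainOfPerms σ τ⟩

theorem bijOn_reverseComplement {n : ℕ} (σ : Equiv.Perm (Fin n)) :
    Set.BijOn (reverseComplement n) (fallingChains σ)
      (fallingChains (longest n * σ * longest n)) := by
  refine Set.InvOn.bijOn (f' := reverseComplement n) ⟨fun c hc => ?_, fun c hc => ?_⟩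
    (mapsTo_reverseComplement σ) ?_
  · exact hc.1.1.reverseComplement_reverseComplement
  · exact hc.1.1.reverseComplement_reverseComplement
  · have := mapsTo_reverseComplement (longest n * σ * longest n)
    rwa [longest_conj_longest_conj] at this

theorem adjacentSwap_rev {n : ℕ} (k : Fin (n - 1)) :
    adjacentSwap n k.rev = longest n * adjacentSwap n k * longest n := by
  have h := Equiv.swap_apply_apply (longest n) ⟨k, by omega⟩ ⟨k + 1, by omega⟩
  rw [longest_inv] at h
  unfold adjacentSwap
  -- `w₀` reverses the order of `k` and `k + 1`, so the two entries have to be exchanged.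
  rw [← h, Equiv.swap_comm]
  congr 1 <;> ext <;> simp only [longest, Fin.revPerm_apply, Fin.val_rev] <;> omega

theorem wordProd_map_rev {n : ℕ} (w : List (Fin (n - 1))) :
    wordProd (w.map Fin.rev) = longest n * wordProd w * longest n := by
  induction w with
  | nil => simp [wordProd, longest_mul_self]
  | cons k w ih =>
    simp only [wordProd, List.map_cons, List.prod_cons] at ih ⊢
    rw [ih, adjacentSwap_rev]
    simp only [mul_assoc]
    rw [← mul_assoc (longest n) (longest n), longest_mul_self, one_mul]

theorem exists_wordProd_eq {n : ℕ} (σ : Equiv.Perm (Fin n)) : ∃ w, wordProd w = σ := by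
  cases n with
  | zero => exact ⟨[], Subsingleton.elim _ _⟩
  | succ n =>
    have h : σ ∈ Submonoid.closure (Set.range (adjacentSwap (n + 1))) := by
      have : Set.range (adjacentSwap (n + 1)) =
          Set.range fun i : Fin n => Equiv.swap i.castSucc i.succ := rfl
      rw [this, Equiv.Perm.mclosure_swap_castSucc_succ]
      trivial
    induction h using Submonoid.closure_induction with
    | mem _ h =>
      obtain ⟨k, rfl⟩ := h
      exact ⟨[k], by simp [wordProd]⟩
    | one => exact ⟨[], rfl⟩
    | mul _ _ _ _ h₁ h₂ =>
      obtain ⟨w₁, rfl⟩ := h₁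
      obtain ⟨w₂, rfl⟩ := h₂
      exact ⟨w₁ ++ w₂, by simp [wordProd]⟩

theorem exists_isReducedWord {n : ℕ} (σ : Equiv.Perm (Fin n)) : ∃ w, IsReducedWord w σ := by
  obtain ⟨w, hw, hmin⟩ := WellFounded.has_min (InvImage.wf List.length Nat.lt_wfRel.wf)
    {w : List (Fin (n - 1)) | wordProd w = σ} (exists_wordProd_eq σ)
  exact ⟨w, hw, fun v hv => not_lt.1 (hmin v hv)⟩

/-- A shorter word for the conjugate would map back, letter by letter, to a shorter word for `σ`. -/
theorem IsReducedWord.map_rev {n : ℕ} {w : List (Fin (n - 1))} {σ : Equiv.Perm (Fin n)}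
    (h : IsReducedWord w σ) :
    IsReducedWord (w.map Fin.rev) (longest n * σ * longest n) := by
  refine ⟨by rw [wordProd_map_rev, h.1], fun v hv => ?_⟩
  have := h.2 (v.map Fin.rev) (by rw [wordProd_map_rev, hv, longest_conj_longest_conj])
  simpa only [List.length_map] using this

end LatticePathMatroid

theorem proposition3p13 (n : ℕ) (σ σ' : Equiv.Perm (Fin n)) :
    (σ' = LatticePathMatroid.longest n * σ * LatticePathMatroid.longest n ↔
      ∃ w : List (Fin (n - 1)),
        LatticePathMatroid.IsReducedWord w σ ∧
          LatticePathMatroid.IsReducedWord (w.map Fin.rev) σ') ∧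
    (σ' = LatticePathMatroid.longest n * σ * LatticePathMatroid.longest n →
      Set.BijOn (LatticePathMatroid.reverseComplement n)
          (LatticePathMatroid.fallingChains σ) (LatticePathMatroid.fallingChains σ') ∧
        (LatticePathMatroid.fallingChains σ).ncard =
          (LatticePathMatroid.fallingChains σ').ncard) := by
  refine ⟨⟨?_, ?_⟩, ?_⟩
  · rintro rfl
    obtain ⟨w, hw⟩ := LatticePathMatroid.exists_isReducedWord σ
    exact ⟨w, hw, hw.map_rev⟩
  · rintro ⟨w, hw, hw'⟩
    rw [← hw'.1, LatticePathMatroid.wordProd_map_rev, hw.1]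
  · rintro rfl
    have h := LatticePathMatroid.bijOn_reverseComplement σ
    exact ⟨h, h.ncard_eq⟩
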